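/- Let $X=\mathbb{R}\times G$ with $G=(\mathbb{Z}(2))^2$, where $\mathbb{Z}(2)=\mathbb{Z}/2\mathbb{Z}$ is discrete, and let $\alpha$ be a topological automorphism of the group $X$ such that $\operatorname{Ker}(I+\alpha)=\{0\}$, where $I$ is the identity automorphism. Let $\xi_1$ and $\xi_2$ be independent random variables with values in $X$ and with distributions $\mu_1$ and $\mu_2$, whose characteristic functions do not vanish, i.e. $\hat\mu_j(y)=\int_X y(x)\,d\mu_j(x)\neq 0$ for every continuous character $y\colon X\to\mathbb{T}=\{z\in\mathbb{C}:|z|=1\}$, $j=1,2$. Suppose that the conditional distribution of $L_2=\xi_1+\alpha\xi_2$ given $L_1=\xi_1+\xi_2$ is symmetric, i.e. for almost every value of $L_1$ (with respect to its distribution) it is invariant under $x\mapsto -x$. Then, for $j=1,2$, $\mu_j=\gamma_j*\omega_j$, where $\gamma_j$ is a Gaussian distribution (possibly degenerate) on $\mathbb{R}$, regarded as a distribution on $X$ concentrated on $\mathbb{R}\times\{0\}$, and $\omega_j$ is a probability distribution on $G$, regarded as a distribution on $X$ concentrated on $\{0\}\times G$. That is, $\mu_j\in\Gamma(\mathbb{R})*\mathrm{M}^1(G)$.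 -/

import Mathlib

open MeasureTheory ProbabilityTheory
open scoped NNReal

namespace HeydeKlein

/-- The finite group `(ℤ(2))²` (discrete topology, every subset measurable). -/
abbrev G : Type := ZMod 2 × ZMod 2

/-- The locally compact Abelian group `ℝ × (ℤ(2))²` with its product topology and its Borel
sets. -/
abbrev X : Type := ℝ × G

/-- The characteristic function of a measure `μ` on a topological Abelian group `A`, evaluated
at a character `y`, i.e. `∫ (x, y) dμ(x)`. -/
noncomputable def groupCharFun {A : Type*} [AddCommGroup A] [MeasurableSpace A]
    (μ : Measure A) (y : AddChar A Circle) : ℂ :=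
  ∫ x, ((y x : Circle) : ℂ) ∂μ

/-- The characteristic function of `μ` vanishes at no continuous unitary character of `A`
(the continuous ones are the elements of the character group). -/
def NonvanishingCharFun {A : Type*} [AddCommGroup A] [TopologicalSpace A] [MeasurableSpace A]
    (μ : Measure A) : Prop :=
  ∀ y : AddChar A Circle, Continuous y → groupCharFun μ y ≠ 0

/-- The conditional distribution of `L₂` given `L₁` (a regular conditional distribution under
`P`) is symmetric: for almost every value `x` of `L₁` it is invariant under negation. -/
def CondDistribSymmetric {Ω A : Type*} [MeasurableSpace Ω] [AddCommGroup A] [MeasurableSpace A]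
    [StandardBorelSpace A] (P : Measure Ω) [IsFiniteMeasure P] (L₂ L₁ : Ω → A) : Prop :=
  ∀ᵐ x ∂(P.map L₁),
    (condDistrib L₂ L₁ P x).map (fun z : A => -z) = condDistrib L₂ L₁ P x

/-- `Γ(ℝ)`: the Gaussian distributions of the real line, with arbitrary mean and arbitrary
variance `v ≥ 0` (degenerate ones included), as distributions on `X` carried by the subgroup
`ℝ × {0}`. -/
def gaussianLine : Set (Measure X) :=
  {γ | ∃ (m : ℝ) (v : ℝ≥0), γ = (gaussianReal m v).map (fun t : ℝ => ((t, 0) : X))}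

/-- `M¹((ℤ(2))²)`: the probability distributions on `X` concentrated at the subgroup
`{0} × (ℤ(2))²`. -/
def finiteDistributions : Set (Measure X) :=
  {ω | IsProbabilityMeasure ω ∧ ω {x : X | x.1 ≠ 0} = 0}

/-- `Γ(ℝ) * M¹((ℤ(2))²)`: all convolutions of an element of the first class with an element of
the second. -/
def gaussianConvFinite : Set (Measure X) :=
  {μ | ∃ γ ∈ gaussianLine, ∃ ω ∈ finiteDistributions, μ = Measure.conv γ ω}

end HeydeKlein

namespace HeydeKlein

/-! An automorphism of `X` splits as `a` on `ℝ` and `A` on `G`. Trivial kernel of `I + α` means that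
`a ≠ -1` and that `I + A` is bijective on the finite group `G`. By independence, symmetry of the
conditional law becomes an equation between characteristic functions in which a character `ψ` is
replaced by `ψ⁻¹`. Characters of `G` are their own inverses, so this replacement only changes the
sign of the real frequency. Since `I + A` is invertible, the `G`-components of the arguments of the
two characteristic functions can be prescribed independently, as `p` and `q`: `f₁ (s + t) p * f₂ (s
+ a * t) q = f₁ (s - t) p * f₂ (s - a * t) q`.

Choosing `s = t`, respectively `s = a * t`, and comparing with trivial `p`, `q` shows that each
characteristic function is a product of its restrictions to the two factors. Hence each distribution
is the convolution of its projections (`eq_conv_of_groupCharFun_eq_mul`). For `p = q = 1` the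
equation is Heyde's on the line, so the real projections are Gaussian (`heyde_real`). -/

/-! ### Heyde's theorem on the real line -/

/-- A nonvanishing continuous function on the line has a continuous logarithm. -/
theorem exists_continuous_log {H : ℝ → ℂ} (hc : Continuous H) (h0 : ∀ t, H t ≠ 0)
    (h1 : H 0 = 1) : ∃ φ : ℝ → ℂ, Continuous φ ∧ φ 0 = 0 ∧ ∀ t, H t = Complex.exp (φ t) := by
  obtain ⟨φ, ⟨h₁, h₂⟩, -⟩ := Complex.isCoveringMapOn_exp.existsUnique_continuousMap_lifts
    (f := ⟨H, hc⟩) (a₀ := (0 : ℝ)) (e₀ := (0 : ℂ)) (by simp [h1]) (fun t => by simpa using h0 t)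
  refine ⟨φ, φ.continuous, h₁, fun t => ?_⟩
  exact (congrFun h₂ t).symm

/-- Both `f` and `0` lift the constant `1` through the covering `exp` and agree at `0`, so
uniqueness of lifts applies. -/
theorem eq_zero_of_exp_eq_one {f : ℝ → ℂ} (hc : Continuous f) (h0 : f 0 = 0)
    (h : ∀ t, Complex.exp (f t) = 1) (t : ℝ) : f t = 0 := by
  obtain ⟨φ, -, hu⟩ := Complex.isCoveringMapOn_exp.existsUnique_continuousMap_lifts
    (f := ContinuousMap.const ℝ (1 : ℂ)) (a₀ := (0 : ℝ)) (e₀ := (0 : ℂ)) (by simp)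
    (fun t => by simp)
  have h₁ := hu ⟨f, hc⟩ ⟨h0, funext h⟩
  have h₂ := hu (ContinuousMap.const ℝ 0) ⟨rfl, funext fun t => by simp⟩
  exact DFunLike.congr_fun (h₁.trans h₂.symm) t

/-- A continuous nonvanishing function with trivial third multiplicative differences is the
exponential of a quadratic polynomial. -/
theorem exists_eq_exp_quadratic {H : ℝ → ℂ} (hc : Continuous H) (h0 : ∀ t, H t ≠ 0)
    (h1 : H 0 = 1)
    (h : ∀ u m n, H (u + m + n) * H u * (H m * H n) = H (u + m) * H (u + n) * H (m + n)) :
    ∃ c d : ℂ, ∀ t : ℝ, H t = Complex.exp (c * t + d * t ^ 2) := by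
  obtain ⟨φ, φc, φ0, hφ⟩ := exists_continuous_log hc h0 h1
  have key : ∀ u m n, φ (u + m + n) = φ (u + m) + φ (u + n) + φ (m + n) - φ u - φ m - φ n := by
    intro u m n
    -- As a function of `u` this combination is continuous, vanishes at `u = 0`, and has exponential
    -- `1`.
    have := eq_zero_of_exp_eq_one
      (f := fun u => φ (u + m + n) + φ u + (φ m + φ n) - (φ (u + m) + φ (u + n) + φ (m + n)))
      (by fun_prop) (by simp only [zero_add, φ0]; ring) (fun u => by
        rw [Complex.exp_sub]
        simp only [Complex.exp_add, ← hφ]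
        rw [h u m n]
        exact div_self (by simp [h0])) u
    linear_combination this
  -- The polar form of `φ`: biadditive by `key`, continuous, hence real bilinear. Removing `b 1 1 /
  -- 2 * t ^ 2` from `φ` then leaves a continuous additive function.
  let b (m : ℝ) : ℝ →+ ℂ :=
    { toFun := fun n => φ (m + n) - φ m - φ n
      map_zero' := by simp [φ0]
      map_add' := fun n k => by rw [← add_assoc, key m n k]; ring }
  have hb1 : ∀ m n, b m n = n * b m 1 := fun m n => by
    have := map_real_smul (b m) (by change Continuous fun n => φ (m + n) - φ m - φ n; fun_prop) n 1
    simpa using this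
  have hsymm : ∀ m n, b m n = b n m := fun m n => by
    change φ (m + n) - φ m - φ n = φ (n + m) - φ n - φ m
    rw [add_comm m n]; ring
  have hb : ∀ m n, φ (m + n) = φ m + φ n + m * n * b 1 1 := fun m n => by
    have h₁ : b m n = φ (m + n) - φ m - φ n := rfl
    rw [hb1, hsymm, hb1] at h₁
    linear_combination -h₁
  let l : ℝ →+ ℂ :=
    { toFun := fun t => φ t - b 1 1 / 2 * t ^ 2
      map_zero' := by simp [φ0]
      map_add' := fun x y => by rw [hb]; push_cast; ring }
  have hl : ∀ t, l t = t * l 1 := fun t => by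
    have := map_real_smul l
      (by change Continuous fun t : ℝ => φ t - b 1 1 / 2 * (t : ℂ) ^ 2; fun_prop) t 1
    simpa using this
  refine ⟨l 1, b 1 1 / 2, fun t => ?_⟩
  rw [hφ]
  have h₁ : l t = φ t - b 1 1 / 2 * t ^ 2 := rfl
  rw [hl] at h₁
  congr 1
  linear_combination -h₁

/-- In the variables `s + t`, `s - t` each factor `F` depends on one variable only, so mixed second
differences eliminate `F`. What remains equates second differences of `log H` at two independent
base points, so they do not depend on the base point and third differences vanish. -/
theorem heyde_third_difference {F H : ℝ → ℂ} {a : ℝ} (ha0 : a ≠ 0) (ha1 : a ≠ 1) (ha : a ≠ -1)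
    (hF : ∀ t, F t ≠ 0) (hH : ∀ t, H t ≠ 0) (hH0 : H 0 = 1)
    (h : ∀ s t, F (s + t) * H (s + a * t) = F (s - t) * H (s - a * t)) (u m n : ℝ) :
    H (u + m + n) * H u * (H m * H n) = H (u + m) * H (u + n) * H (m + n) := by
  have E : ∀ x y, F x * H ((1 + a) / 2 * x + (1 - a) / 2 * y)
      = F y * H ((1 - a) / 2 * x + (1 + a) / 2 * y) := fun x y => by
    have := h ((x + y) / 2) ((x - y) / 2)
    ring_nf at this ⊢
    exact this
  have hp : (1 - a) / 2 ≠ 0 := by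
    intro hh; apply ha1; linarith
  have hq : (1 + a) / 2 ≠ 0 := by
    intro hh; apply ha; linarith
  set p := (1 - a) / 2 with hpd
  set q := (1 + a) / 2 with hqd
  have hpq : q ^ 2 - p ^ 2 ≠ 0 := by
    have : q ^ 2 - p ^ 2 = a := by rw [hpd, hqd]; ring
    rwa [this]
  -- Multiply `E` at two opposite corners of the rectangle `(x, y)`, `(x + h, y + k)` and divide by
  -- `E` at the other two. The base points `u`, `w` are arbitrary because the determinant `q ^ 2 - p
  -- ^ 2 = a` is nonzero.
  have K : ∀ u w h k, H w * H (w + q * h + p * k) * (H (u + p * h) * H (u + q * k))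
      = H u * H (u + p * h + q * k) * (H (w + q * h) * H (w + p * k)) := by
    intro u w h k
    obtain ⟨x, y, rfl, rfl⟩ : ∃ x y, u = p * x + q * y ∧ w = q * x + p * y :=
      ⟨(q * w - p * u) / (q ^ 2 - p ^ 2), (q * u - p * w) / (q ^ 2 - p ^ 2),
        by field_simp; ring, by field_simp; ring⟩
    have e1 := E x y
    have e2 := E (x + h) y
    have e3 := E x (y + k)
    have e4 := E (x + h) (y + k)
    rw [show q * (x + h) + p * y = q * x + p * y + q * h by ring,
      show p * (x + h) + q * y = p * x + q * y + p * h by ring] at e2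
    rw [show q * x + p * (y + k) = q * x + p * y + p * k by ring,
      show p * x + q * (y + k) = p * x + q * y + q * k by ring] at e3
    rw [show q * (x + h) + p * (y + k) = q * x + p * y + q * h + p * k by ring,
      show p * (x + h) + q * (y + k) = p * x + q * y + p * h + q * k by ring] at e4
    have hne : F x * F (x + h) * (F y * F (y + k)) ≠ 0 := by simp [hF]
    apply mul_left_cancel₀ hne
    calc _ = (F x * H (q * x + p * y)) * (F (x + h) * H (q * x + p * y + q * h + p * k))
          * ((F y * H (p * x + q * y + p * h)) * (F (y + k) * H (p * x + q * y + q * k))) := by ring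
      _ = _ := by rw [e1, e4, ← e2, ← e3]; ring
  -- With `w = 0` fixed, the base points `u` and `0` are compared; the steps are scaled so that the
  -- increments at `u` are `m` and `n`.
  have K₁ := K u 0 (m / p) (n / q)
  have K₂ := K 0 0 (m / p) (n / q)
  rw [mul_div_cancel₀ _ hp, mul_div_cancel₀ _ hq] at K₁ K₂
  simp only [zero_add, hH0, one_mul] at K₁ K₂
  have hne : H (q * (m / p)) * H (p * (n / q)) ≠ 0 := by simp [hH]
  apply mul_right_cancel₀ hne
  linear_combination (-(H m * H n)) * K₁ + H (u + m) * H (u + n) * K₂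

/-- A characteristic function that is the exponential of a quadratic polynomial is Gaussian. -/
theorem exists_eq_gaussianReal_of_charFun_eq {μ : Measure ℝ} [IsProbabilityMeasure μ] {c d : ℂ}
    (h : ∀ t : ℝ, charFun μ t = Complex.exp (c * t + d * t ^ 2)) :
    ∃ (m : ℝ) (v : ℝ≥0), μ = gaussianReal m v := by
  -- Hermitian symmetry of `charFun` gives equality of the exponents modulo `2πi`; continuity makes
  -- it exact. So `c` is imaginary and `d` real, while `‖charFun μ 1‖ ≤ 1` gives `d ≤ 0`.
  have hconj : ∀ t : ℝ, (starRingEnd ℂ) (c * t + d * t ^ 2) = -(c * t) + d * t ^ 2 := by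
    suffices H : ∀ t : ℝ, (starRingEnd ℂ) (c * t + d * t ^ 2) - (-(c * t) + d * t ^ 2) = 0 from
      fun t => sub_eq_zero.1 (H t)
    refine eq_zero_of_exp_eq_one ?_ (by simp) fun t => ?_
    · exact (Complex.continuous_conj.comp (by fun_prop)).sub (by fun_prop)
    · have h₁ := charFun_neg (μ := μ) t
      rw [h, h, ← Complex.exp_conj] at h₁
      rw [Complex.exp_sub, ← h₁]
      push_cast
      rw [show c * -(t : ℂ) + d * (-(t : ℂ)) ^ 2 = -(c * t) + d * t ^ 2 by ring]
      exact div_self (Complex.exp_ne_zero _)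
  have h₁ := hconj 1
  have h₂ := hconj (-1)
  simp only [map_add, map_mul, Complex.ofReal_one, Complex.ofReal_neg, map_neg, map_one,
    mul_one, one_pow, map_pow] at h₁ h₂
  norm_num at h₂
  have hdim : (starRingEnd ℂ) d = d := by linear_combination (h₁ + h₂) / 2
  have hcre : (starRingEnd ℂ) c = -c := by linear_combination (h₁ - h₂) / 2
  have hd : d = (d.re : ℂ) := (Complex.conj_eq_iff_re.1 hdim).symm
  have hc : c = Complex.I * c.im := by
    have : c.re = 0 := by
      have := congrArg Complex.re hcre
      simp at this
      linarith
    apply Complex.ext <;> simp [this]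
  have hle : d.re ≤ 0 := by
    have := norm_charFun_le_one (μ := μ) 1
    rw [h, hc, hd, Complex.norm_exp] at this
    simpa using this
  obtain ⟨v, hv⟩ : ∃ v : ℝ≥0, (v : ℝ) = -2 * d.re := ⟨⟨-2 * d.re, by linarith⟩, rfl⟩
  refine ⟨c.im, v, Measure.ext_of_charFun (funext fun t => ?_)⟩
  rw [h, charFun_gaussianReal]
  congr 1
  have hv' : (v : ℂ) = -2 * d := by
    rw [hd]
    exact_mod_cast congrArg (Complex.ofReal) hv
  linear_combination (t : ℂ) * hc + (t : ℂ) ^ 2 / 2 * hv'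

/-- The difference of two independent copies has characteristic function `‖charFun μ t‖ ^ 2 = 1`, so
it is almost surely `0`; by Fubini one copy is almost surely equal to a fixed value of the other. -/
theorem exists_eq_dirac_of_norm_charFun_eq_one {μ : Measure ℝ} [IsProbabilityMeasure μ]
    (h : ∀ t, ‖charFun μ t‖ = 1) : ∃ m, μ = Measure.dirac m := by
  have hneg : ∀ t, charFun (μ.map (fun x => (-1 : ℝ) * x)) t = charFun μ (-t) := fun t => by
    rw [charFun_map_mul]; simp
  have hp : IsProbabilityMeasure (μ.map (fun x => (-1 : ℝ) * x)) :=
    Measure.isProbabilityMeasure_map (by fun_prop)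
  have hd : μ.conv (μ.map (fun x => (-1 : ℝ) * x)) = Measure.dirac 0 := by
    refine Measure.ext_of_charFun (funext fun t => ?_)
    rw [charFun_conv, hneg, charFun_neg, Complex.mul_conj, Complex.normSq_eq_norm_sq, h]
    simp
  have hae : ∀ᵐ z ∂(μ.prod (μ.map (fun x => (-1 : ℝ) * x))), z.1 + z.2 = 0 := by
    have : ∀ᵐ x ∂(μ.conv (μ.map (fun x => (-1 : ℝ) * x))), x = 0 := by
      rw [hd, ae_dirac_eq]; simp
    exact ae_of_ae_map (by fun_prop) this
  have h2 := Measure.ae_ae_of_ae_prod hae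
  obtain ⟨m, hm⟩ := h2.exists
  have hm' := ae_of_ae_map (by fun_prop) hm
  refine ⟨m, ?_⟩
  have e : (fun x : ℝ => x) =ᵐ[μ] fun _ => m := by
    filter_upwards [hm'] with x hx
    linarith
  simpa using Measure.map_congr (mβ := Real.measurableSpace) e

/-- Heyde's theorem on the real line for two independent variables, in terms of characteristic
functions. -/
theorem heyde_real {μ ν : Measure ℝ} [IsProbabilityMeasure μ] [IsProbabilityMeasure ν] {a : ℝ}
    (ha0 : a ≠ 0) (ha : a ≠ -1) (hμ : ∀ t, charFun μ t ≠ 0) (hν : ∀ t, charFun ν t ≠ 0)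
    (h : ∀ s t, charFun μ (s + t) * charFun ν (s + a * t)
      = charFun μ (s - t) * charFun ν (s - a * t)) :
    (∃ (m : ℝ) (v : ℝ≥0), μ = gaussianReal m v) ∧ ∃ (m : ℝ) (v : ℝ≥0), ν = gaussianReal m v := by
  have hμ0 : charFun μ 0 = 1 := by simp
  have hν0 : charFun ν 0 = 1 := by simp
  -- For `a = 1` the equation says only that the product of the characteristic functions is
  -- constant, so both have modulus `1` and the laws are degenerate.
  by_cases ha1 : a = 1
  · subst ha1
    have h₁ : ∀ t, charFun μ t * charFun ν t = 1 := fun t => by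
      have := h (t / 2) (t / 2)
      rw [one_mul, sub_self, hμ0, hν0, add_halves] at this
      simpa using this
    have h₂ : ∀ t, ‖charFun μ t‖ * ‖charFun ν t‖ = 1 := fun t => by
      rw [← norm_mul, h₁, norm_one]
    have hμn : ∀ t, ‖charFun μ t‖ = 1 := fun t => by
      nlinarith [h₂ t, norm_charFun_le_one (μ := μ) t, norm_charFun_le_one (μ := ν) t,
        norm_nonneg (charFun μ t), norm_nonneg (charFun ν t)]
    have hνn : ∀ t, ‖charFun ν t‖ = 1 := fun t => by simpa [hμn t] using h₂ t
    obtain ⟨m, hm⟩ := exists_eq_dirac_of_norm_charFun_eq_one hμn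
    obtain ⟨n, hn⟩ := exists_eq_dirac_of_norm_charFun_eq_one hνn
    exact ⟨⟨m, 0, by simpa using hm⟩, n, 0, by simpa using hn⟩
  · obtain ⟨c, d, hcd⟩ := exists_eq_exp_quadratic continuous_charFun hν hν0
      (heyde_third_difference ha0 ha1 ha hμ hν hν0 h)
    refine ⟨?_, exists_eq_gaussianReal_of_charFun_eq hcd⟩
    -- The equation at `s = t` expresses `charFun μ t` as the quotient of `charFun ν` at `(1 - a) /
    -- 2 * t` and `(1 + a) / 2 * t`.
    refine exists_eq_gaussianReal_of_charFun_eq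
      (c := c * ((1 - a) / 2) - c * ((1 + a) / 2))
      (d := d * ((1 - a) / 2) ^ 2 - d * ((1 + a) / 2) ^ 2) fun t => ?_
    have h₁ := h (t / 2) (t / 2)
    rw [sub_self, hμ0, one_mul, add_halves, hcd, hcd] at h₁
    rw [← eq_div_iff (Complex.exp_ne_zero _), ← Complex.exp_sub] at h₁
    rw [h₁]
    congr 1
    push_cast
    ring

/-! ### From conditional symmetry to the functional equation -/

/-- The joint law is the law of `L₁` composed with the conditional kernel, and negating `L₂` changes
only the kernel, by a reflection that preserves it almost everywhere. -/
theorem map_eq_map_neg_of_condDistribSymmetric {Ω A : Type*} [MeasurableSpace Ω] [AddCommGroup A]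
    [MeasurableSpace A] [StandardBorelSpace A] [MeasurableNeg A] {P : Measure Ω}
    [IsFiniteMeasure P] {L₂ L₁ : Ω → A} (h₁ : Measurable L₁) (h₂ : Measurable L₂)
    (h : CondDistribSymmetric P L₂ L₁) :
    P.map (fun w => (L₁ w, L₂ w)) = P.map (fun w => (L₁ w, -L₂ w)) := by
  have e : (fun w => (L₁ w, -L₂ w)) = Prod.map id (fun z : A => -z) ∘ fun w => (L₁ w, L₂ w) := rfl
  rw [e, ← Measure.map_map (by fun_prop) (by fun_prop),
    ← compProd_map_condDistrib h₂.aemeasurable, ← Measure.compProd_map (by fun_prop)]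
  refine Measure.compProd_congr ?_
  filter_upwards [h] with x hx
  rw [Kernel.map_apply _ (by fun_prop), hx]

/-- The functional equation of Heyde's problem. -/
theorem groupCharFun_heyde {Ω A : Type*} [MeasurableSpace Ω] [AddCommGroup A]
    [TopologicalSpace A] [IsTopologicalAddGroup A] [SecondCountableTopology A]
    [MeasurableSpace A] [BorelSpace A] [StandardBorelSpace A]
    {P : Measure Ω} [IsProbabilityMeasure P] {ξ₁ ξ₂ : Ω → A} (hξ₁ : Measurable ξ₁)
    (hξ₂ : Measurable ξ₂) (hindep : IndepFun ξ₁ ξ₂ P) (α : A →+ A) (hα : Continuous α)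
    (h : CondDistribSymmetric P (fun w => ξ₁ w + α (ξ₂ w)) (fun w => ξ₁ w + ξ₂ w))
    (χ ψ : AddChar A Circle) (hχ : Continuous χ) (hψ : Continuous ψ) :
    groupCharFun (P.map ξ₁) (χ * ψ) * groupCharFun (P.map ξ₂) (χ * ψ.compAddMonoidHom α) =
      groupCharFun (P.map ξ₁) (χ * ψ⁻¹) * groupCharFun (P.map ξ₂) (χ * (ψ.compAddMonoidHom α)⁻¹) := by
  have hm : ∀ y : AddChar A Circle, Continuous y → Measurable fun x => ((y x : Circle) : ℂ) :=
    fun y hy => (continuous_subtype_val.comp hy).measurable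
  have hmα : Measurable α := hα.measurable
  -- By independence the product is the characteristic function of the joint law of `(L₁, L₂)` at
  -- `(χ, θ)`. Reflecting `L₂` then exchanges `ψ` and `ψ⁻¹`.
  have key : ∀ θ : AddChar A Circle, Continuous θ →
      groupCharFun (P.map ξ₁) (χ * θ) * groupCharFun (P.map ξ₂) (χ * θ.compAddMonoidHom α) =
      ∫ z, ((χ z.1 : Circle) : ℂ) * ((θ z.2 : Circle) : ℂ)
        ∂(P.map fun w => (ξ₁ w + ξ₂ w, ξ₁ w + α (ξ₂ w))) := by
    intro θ hθ
    have c₁ : Continuous (χ * θ : AddChar A Circle) := hχ.mul hθ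
    have c₂ : Continuous (χ * θ.compAddMonoidHom α : AddChar A Circle) := hχ.mul (hθ.comp hα)
    have m₁ := hm _ hχ
    have m₂ := hm _ hθ
    rw [integral_map (by fun_prop) (by fun_prop)]
    unfold groupCharFun
    rw [integral_map hξ₁.aemeasurable (hm _ c₁).aestronglyMeasurable,
      integral_map hξ₂.aemeasurable (hm _ c₂).aestronglyMeasurable,
      ← hindep.integral_fun_comp_mul_comp hξ₁.aemeasurable hξ₂.aemeasurable
        (hm _ c₁).aestronglyMeasurable (hm _ c₂).aestronglyMeasurable]
    congr 1 with w
    simp only [AddChar.mul_apply, AddChar.compAddMonoidHom_apply, AddChar.map_add_eq_mul,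
      Circle.coe_mul]
    ring
  have c₃ : Continuous (ψ⁻¹ : AddChar A Circle) := hψ.comp continuous_neg
  have m₁ := hm _ hχ
  have m₂ := hm _ hψ
  have m₃ := hm _ c₃
  rw [key ψ hψ, map_eq_map_neg_of_condDistribSymmetric (by fun_prop) (by fun_prop) h,
    integral_map (by fun_prop) (by fun_prop),
    show (ψ.compAddMonoidHom α)⁻¹ = (ψ⁻¹).compAddMonoidHom α from by ext; simp [AddChar.inv_apply],
    key _ c₃, integral_map (by fun_prop) (by fun_prop)]
  simp only [AddChar.inv_apply]

/-! ### Characters and automorphisms of `ℝ × G` -/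

/-- The character `(x, k) ↦ exp (i s x) g k` of `ℝ × G`. -/
noncomputable def prodChar (s : ℝ) (g : AddChar G Circle) : AddChar X Circle where
  toFun x := Circle.exp (s * x.1) * g x.2
  map_zero_eq_one' := by simp
  map_add_eq_mul' x y := by
    simp only [Prod.fst_add, Prod.snd_add, mul_add, Circle.exp_add, AddChar.map_add_eq_mul]
    exact mul_mul_mul_comm _ _ _ _

theorem prodChar_apply (s : ℝ) (g : AddChar G Circle) (x : X) :
    prodChar s g x = Circle.exp (s * x.1) * g x.2 := rfl

theorem continuous_prodChar (s : ℝ) (g : AddChar G Circle) : Continuous (prodChar s g) := by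
  have : Continuous g := continuous_of_discreteTopology
  change Continuous fun x : X => Circle.exp (s * x.1) * g x.2
  fun_prop

theorem prodChar_mul (s t : ℝ) (g h : AddChar G Circle) :
    prodChar s g * prodChar t h = prodChar (s + t) (g * h) := by
  ext x
  simp only [AddChar.mul_apply, prodChar_apply, add_mul, Circle.exp_add]
  rw [mul_mul_mul_comm]

theorem prodChar_inv (s : ℝ) (g : AddChar G Circle) :
    (prodChar s g)⁻¹ = prodChar (-s) g⁻¹ := by
  ext x
  simp [AddChar.inv_apply, prodChar_apply]

theorem inv_addChar_G (g : AddChar G Circle) : g⁻¹ = g := by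
  ext k
  rw [AddChar.inv_apply]
  congr 2
  revert k; decide

theorem groupCharFun_prodChar_one (μ : Measure X) (s : ℝ) :
    groupCharFun μ (prodChar s 1) = charFun (μ.map Prod.fst) s := by
  rw [charFun_apply_real, integral_map (by fun_prop) (by fun_prop)]
  simp [groupCharFun, prodChar_apply]

/-- A topological automorphism of `ℝ × G` is the product of an automorphism of each factor. -/
theorem exists_eq_prod (α : X ≃ₜ+ X) :
    ∃ (a : ℝ) (A : G →+ G), ∀ x, α x = (a * x.1, A x.2) := by
  let A : G →+ G := ((AddMonoidHom.snd ℝ G).comp (α : X →+ X)).comp (AddMonoidHom.inr ℝ G)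
  let l : ℝ →+ ℝ := ((AddMonoidHom.fst ℝ G).comp (α : X →+ X)).comp (AddMonoidHom.inl ℝ G)
  have hl : Continuous l := by
    change Continuous fun t : ℝ => (α (t, 0)).1
    exact continuous_fst.comp (α.continuous.comp (by fun_prop))
  have h₁ : ∀ t : ℝ, α (t, 0) = (l 1 * t, 0) := fun t => by
    apply Prod.ext
    · have := map_real_smul l hl t 1
      rw [smul_eq_mul, smul_eq_mul, mul_one, mul_comm] at this
      exact this
    -- A continuous map from the connected line to a discrete group is constant.
    · have hc : Continuous fun t : ℝ => (α (t, 0)).2 :=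
        continuous_snd.comp (α.continuous.comp (by fun_prop))
      have := PreconnectedSpace.constant (inferInstance : PreconnectedSpace ℝ) hc (x := t) (y := 0)
      rw [this]
      change (α 0).2 = 0
      simp
  have h₂ : ∀ k : G, α (0, k) = (0, A k) := fun k => by
    apply Prod.ext
    -- Elements of order two go to elements of order at most two, and `ℝ` has no torsion.
    · have : α ((0, k) + (0, k)) = 0 := by
        rw [show ((0, k) + (0, k) : X) = 0 from ?_, map_zero]
        ext1
        · simp
        · revert k; decide
      rw [map_add] at this
      have := congrArg Prod.fst this
      simp only [Prod.fst_add, Prod.fst_zero] at this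
      change (α (0, k)).1 = 0
      linarith
    · rfl
  refine ⟨l 1, A, fun x => ?_⟩
  have : x = (x.1, 0) + (0, x.2) := by ext1 <;> simp
  conv_lhs => rw [this, map_add, h₁, h₂]
  ext1 <;> simp

/-! ### Uniqueness and factorization of distributions on `ℝ × G` -/

/-- Orthogonality of the characters of `G`, with `4` the order of `G`. It recovers the part of a
measure on each line `ℝ × {k}`, so uniqueness on `X` reduces to uniqueness on `ℝ`. -/
theorem indicator_eq_sum_addChar (k : G) (s : ℝ) (x : X) :
    (Prod.snd ⁻¹' {k} : Set X).indicator (fun x : X => Complex.exp (s * x.1 * Complex.I)) x =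
      ∑ g : AddChar G ℂ, (4⁻¹ * g (-k)) *
        ((prodChar s (AddChar.circleEquivComplex.symm g) x : Circle) : ℂ) := by
  have hg : ∀ g : AddChar G ℂ,
      ((AddChar.circleEquivComplex.symm g x.2 : Circle) : ℂ) = g x.2 := fun g => by
    conv_rhs => rw [← AddChar.circleEquivComplex.apply_symm_apply g]
    rfl
  have e : ∀ g : AddChar G ℂ, (4⁻¹ * g (-k)) *
        ((prodChar s (AddChar.circleEquivComplex.symm g) x : Circle) : ℂ) =
        4⁻¹ * Complex.exp (s * x.1 * Complex.I) * g (x.2 - k) := fun g => by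
    rw [prodChar_apply, Circle.coe_mul, hg, sub_eq_add_neg, AddChar.map_add_eq_mul,
      Circle.coe_exp]
    push_cast
    ring
  rw [Finset.sum_congr rfl fun g _ => e g, ← Finset.mul_sum, AddChar.sum_apply_eq_ite]
  by_cases hx : x.2 = k
  · simp [Set.indicator, hx]
    ring
  · simp [Set.indicator, hx, sub_eq_zero]

theorem charFun_map_restrict (μ : Measure X) [IsFiniteMeasure μ] (k : G) (s : ℝ) :
    charFun ((μ.restrict (Prod.snd ⁻¹' {k})).map Prod.fst) s =
      ∑ g : AddChar G ℂ, (4⁻¹ * g (-k)) *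
        groupCharFun μ (prodChar s (AddChar.circleEquivComplex.symm g)) := by
  have hk : MeasurableSet (Prod.snd ⁻¹' {k} : Set X) := measurable_snd (measurableSet_singleton k)
  rw [charFun_apply_real, integral_map (by fun_prop) (by fun_prop), ← integral_indicator hk]
  simp_rw [indicator_eq_sum_addChar, groupCharFun]
  rw [integral_finsetSum]
  · simp_rw [integral_const_mul]
  · intro g _
    refine Integrable.const_mul (Integrable.of_bound (C := 1) ?_
      (ae_of_all _ fun x => (Circle.norm_coe _).le)) _
    exact (continuous_subtype_val.comp (continuous_prodChar _ _)).measurable.aestronglyMeasurable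

/-- A finite measure on `ℝ × G` is determined by its characteristic function. -/
theorem ext_of_groupCharFun {μ ν : Measure X} [IsFiniteMeasure μ] [IsFiniteMeasure ν]
    (h : ∀ s g, groupCharFun μ (prodChar s g) = groupCharFun ν (prodChar s g)) : μ = ν := by
  have key : ∀ k, (μ.restrict (Prod.snd ⁻¹' {k})).map Prod.fst =
      (ν.restrict (Prod.snd ⁻¹' {k})).map Prod.fst := fun k => by
    refine Measure.ext_of_charFun (funext fun s => ?_)
    simp_rw [charFun_map_restrict, h]
  have hk : ∀ k, MeasurableSet (Prod.snd ⁻¹' {k} : Set X) :=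
    fun k => measurable_snd (measurableSet_singleton k)
  ext S hS
  have hsum : ∀ ρ : Measure X, ∑ k : G, ρ (Prod.snd ⁻¹' {k} ∩ S) = ρ S := fun ρ => by
    have := sum_measure_preimage_singleton (μ := ρ.restrict S) (Finset.univ : Finset G)
      (f := Prod.snd) (fun k _ => hk k)
    simpa [Measure.restrict_apply (hk _)] using this
  rw [← hsum μ, ← hsum ν]
  refine Finset.sum_congr rfl fun k _ => ?_
  have hsec : MeasurableSet ((fun t : ℝ => ((t, k) : X)) ⁻¹' S) := measurable_prodMk_right hS
  have e := congrArg (fun ρ => ρ ((fun t : ℝ => ((t, k) : X)) ⁻¹' S)) (key k)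
  simp only [Measure.map_apply measurable_fst hsec,
    Measure.restrict_apply (measurable_fst hsec)] at e
  have hset : Prod.fst ⁻¹' ((fun t : ℝ => ((t, k) : X)) ⁻¹' S) ∩ Prod.snd ⁻¹' {k} =
      Prod.snd ⁻¹' {k} ∩ S := by
    ext ⟨t, l⟩
    simp only [Set.mem_inter_iff, Set.mem_preimage, Set.mem_singleton_iff]
    constructor
    · rintro ⟨h₁, rfl⟩
      exact ⟨rfl, h₁⟩
    · rintro ⟨rfl, h₁⟩
      exact ⟨h₁, rfl⟩
  rwa [hset] at e

/-- A distribution on `ℝ × G` whose characteristic function is a product is the convolution of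
its projections. -/
theorem eq_conv_of_groupCharFun_eq_mul {μ : Measure X} [IsProbabilityMeasure μ]
    (h : ∀ s g, groupCharFun μ (prodChar s g) =
      groupCharFun μ (prodChar 0 g) * groupCharFun μ (prodChar s 1)) :
    μ = Measure.conv ((μ.map Prod.fst).map (fun t : ℝ => ((t, 0) : X)))
      ((μ.map Prod.snd).map (fun k : G => ((0, k) : X))) := by
  have hν : IsProbabilityMeasure (μ.map Prod.fst) :=
    Measure.isProbabilityMeasure_map (by fun_prop)
  have hω : IsProbabilityMeasure (μ.map Prod.snd) :=
    Measure.isProbabilityMeasure_map (by fun_prop)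
  have hconv : Measure.conv ((μ.map Prod.fst).map (fun t : ℝ => ((t, 0) : X)))
      ((μ.map Prod.snd).map (fun k : G => ((0, k) : X)))
      = (μ.map Prod.fst).prod (μ.map Prod.snd) := by
    rw [Measure.conv, Measure.map_prod_map _ _ (by fun_prop) (by fun_prop),
      Measure.map_map (by fun_prop) (by fun_prop)]
    convert! Measure.map_id
    ext1
    simp
  rw [hconv]
  refine ext_of_groupCharFun fun s g => ?_
  rw [h, groupCharFun_prodChar_one, charFun_apply_real, mul_comm]
  simp only [groupCharFun, prodChar_apply, Circle.coe_mul, zero_mul, Circle.exp_zero, one_mul,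
    Circle.coe_exp, Complex.ofReal_mul]
  rw [integral_prod_mul (fun t : ℝ => Complex.exp (s * t * Complex.I))
    (fun k : G => ((g k : Circle) : ℂ)), integral_map (φ := Prod.snd) (by fun_prop)]
  exact (measurable_of_finite _).aestronglyMeasurable

theorem mem_gaussianConvFinite {μ : Measure X} [IsProbabilityMeasure μ] {m : ℝ} {v : ℝ≥0}
    (hg : μ.map Prod.fst = gaussianReal m v)
    (h : ∀ s g, groupCharFun μ (prodChar s g) =
      groupCharFun μ (prodChar 0 g) * groupCharFun μ (prodChar s 1)) :
    μ ∈ gaussianConvFinite := by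
  have hω : IsProbabilityMeasure (μ.map Prod.snd) :=
    Measure.isProbabilityMeasure_map (by fun_prop)
  refine ⟨_, ⟨m, v, rfl⟩, (μ.map Prod.snd).map (fun k : G => ((0, k) : X)), ⟨?_, ?_⟩, ?_⟩
  · exact Measure.isProbabilityMeasure_map (by fun_prop)
  · rw [Measure.map_apply (by fun_prop) (by measurability)]
    simp
  · rw [← hg]
    exact eq_conv_of_groupCharFun_eq_mul h

end HeydeKlein

open HeydeKlein

/-! ### The theorem -/

theorem proposition2p2
    (α : HeydeKlein.X ≃ₜ+ HeydeKlein.X)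
    (hα : ∀ x : HeydeKlein.X, x + α x = 0 → x = 0)
    {Ω : Type*} [MeasurableSpace Ω] (P : Measure Ω) [IsProbabilityMeasure P]
    (ξ₁ ξ₂ : Ω → HeydeKlein.X) (hξ₁ : Measurable ξ₁) (hξ₂ : Measurable ξ₂)
    (hindep : IndepFun ξ₁ ξ₂ P)
    (hchar₁ : HeydeKlein.NonvanishingCharFun (P.map ξ₁))
    (hchar₂ : HeydeKlein.NonvanishingCharFun (P.map ξ₂))
    (hsymm : HeydeKlein.CondDistribSymmetric P
      (fun w => ξ₁ w + α (ξ₂ w)) (fun w => ξ₁ w + ξ₂ w)) :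
    P.map ξ₁ ∈ HeydeKlein.gaussianConvFinite ∧ P.map ξ₂ ∈ HeydeKlein.gaussianConvFinite := by
  obtain ⟨a, A, hαA⟩ := exists_eq_prod α
  have ha0 : a ≠ 0 := by
    rintro rfl
    have : α ((1 : ℝ), (0 : G)) = α 0 := by simp [hαA]
    simpa using congrArg Prod.fst (α.injective this)
  have ha : a ≠ -1 := by
    rintro rfl
    have := hα ((1 : ℝ), (0 : G)) (by rw [hαA]; ext1 <;> simp)
    simpa using congrArg Prod.fst this
  have hinj : Function.Injective (AddMonoidHom.id G + A) := by
    refine (injective_iff_map_eq_zero _).2 fun k hk => ?_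
    have := hα ((0 : ℝ), k) (by rw [hαA]; ext1; · simp
                                · simpa using hk)
    exact congrArg Prod.snd this
  let B : G ≃+ G := AddEquiv.ofBijective (AddMonoidHom.id G + A)
    ⟨hinj, Finite.surjective_of_injective hinj⟩
  have hB : ∀ k, B k = k + A k := fun k => rfl
  have hp₁ : IsProbabilityMeasure (P.map ξ₁) := Measure.isProbabilityMeasure_map hξ₁.aemeasurable
  have hp₂ : IsProbabilityMeasure (P.map ξ₂) := Measure.isProbabilityMeasure_map hξ₂.aemeasurable
  have i₁ : IsProbabilityMeasure ((P.map ξ₁).map Prod.fst) :=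
    Measure.isProbabilityMeasure_map (by fun_prop)
  have i₂ : IsProbabilityMeasure ((P.map ξ₂).map Prod.fst) :=
    Measure.isProbabilityMeasure_map (by fun_prop)
  set f₁ : ℝ → AddChar G Circle → ℂ := fun s g => groupCharFun (P.map ξ₁) (prodChar s g) with hf₁
  set f₂ : ℝ → AddChar G Circle → ℂ := fun s g => groupCharFun (P.map ξ₂) (prodChar s g) with hf₂
  have n₁ : ∀ s g, f₁ s g ≠ 0 := fun s g => hchar₁ _ (continuous_prodChar s g)
  have n₂ : ∀ s g, f₂ s g ≠ 0 := fun s g => hchar₂ _ (continuous_prodChar s g)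
  have E : ∀ s t p q, f₁ (s + t) p * f₂ (s + a * t) q = f₁ (s - t) p * f₂ (s - a * t) q := by
    intro s t p q
    -- Chosen so that `h * (h ∘ A) = p * q`. With `χ = (s, p * h)` and `ψ = (t, h)` the
    -- `G`-components become `p * h * h = p` and `p * h * (h ∘ A) = p * p * q = q`.
    let h : AddChar G Circle := (p * q).compAddMonoidHom (B.symm : G →+ G)
    have hh : h * h.compAddMonoidHom A = p * q := by
      ext k
      have : h k * h (A k) = (p * q) k := by
        rw [← AddChar.map_add_eq_mul, ← hB]
        simp [h]
      exact congrArg _ this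
    have e := groupCharFun_heyde hξ₁ hξ₂ hindep (α : X →+ X) α.continuous hsymm
      (prodChar s (p * h)) (prodChar t h) (continuous_prodChar _ _) (continuous_prodChar _ _)
    have hcomp : (prodChar t h).compAddMonoidHom (α : X →+ X)
        = prodChar (a * t) (h.compAddMonoidHom A) := by
      ext x
      have : α x = (a * x.1, A x.2) := hαA x
      simp only [AddChar.compAddMonoidHom_apply, prodChar_apply, AddMonoidHom.coe_coe, this]
      ring_nf
    have hsq : ∀ g : AddChar G Circle, g * g = 1 := fun g => by
      nth_rw 1 [← inv_addChar_G g]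
      simp
    have hq : p * h * h.compAddMonoidHom A = q := by
      rw [mul_assoc, hh, ← mul_assoc, hsq, one_mul]
    rw [hcomp, prodChar_inv, prodChar_inv, inv_addChar_G, inv_addChar_G, prodChar_mul,
      prodChar_mul, prodChar_mul, prodChar_mul, hq, mul_assoc, hsq, mul_one,
      ← sub_eq_add_neg, ← sub_eq_add_neg] at e
    exact e
  have c₁ : ∀ s g, f₁ s g = f₁ 0 g * f₁ s 1 := fun s g => by
    -- Here `s - t = 0`, and the `f₂` factors do not involve `g`, so they cancel against the case `g
    -- = 1`.
    have e₁ := E (s / 2) (s / 2) g 1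
    have e₂ := E (s / 2) (s / 2) 1 1
    rw [add_halves, sub_self] at e₁ e₂
    have : f₁ 0 1 = 1 := by simp only [hf₁, groupCharFun_prodChar_one]; simp
    rw [this] at e₂
    apply mul_right_cancel₀ (n₂ (s / 2 + a * (s / 2)) 1)
    linear_combination e₁ - f₁ 0 g * e₂
  have c₂ : ∀ s g, f₂ s g = f₂ 0 g * f₂ s 1 := fun s g => by
    -- Now `a * t = s / 2`, so the arguments of `f₂` are `s` and `0`, and the `f₁` factors cancel.
    have e₁ := E (s / 2) (s / 2 / a) 1 g
    have e₂ := E (s / 2) (s / 2 / a) 1 1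
    rw [mul_div_cancel₀ _ ha0, add_halves, sub_self] at e₁ e₂
    have : f₂ 0 1 = 1 := by simp only [hf₂, groupCharFun_prodChar_one]; simp
    rw [this] at e₂
    apply mul_left_cancel₀ (n₁ (s / 2 + s / 2 / a) 1)
    linear_combination e₁ - f₂ 0 g * e₂
  obtain ⟨⟨m₁, v₁, h₁⟩, m₂, v₂, h₂⟩ := heyde_real (μ := (P.map ξ₁).map Prod.fst)
    (ν := (P.map ξ₂).map Prod.fst) ha0 ha
    (fun t => groupCharFun_prodChar_one (P.map ξ₁) t ▸ n₁ t 1)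
    (fun t => groupCharFun_prodChar_one (P.map ξ₂) t ▸ n₂ t 1)
    (fun s t => by simpa only [hf₁, hf₂, groupCharFun_prodChar_one] using E s t 1 1)
  exact ⟨mem_gaussianConvFinite h₁ c₁, mem_gaussianConvFinite h₂ c₂⟩
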